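/- **Selective learning.** An instance with sequence length $n$ consists of an instance space $\mathcal X$, a label space $\mathcal Y$, a loss function $\ell:\mathcal Y\times\mathcal Y\to[0,1]$, a finite nonempty model class $\mathcal F$ of functions $\mathcal X\to\mathcal Y$, equivalently the family $\mathcal L=\{\ell_f : f\in\mathcal F\}$ of functions $\ell_f(x,y)=\ell(f(x),y)$ on $\mathcal Z=\mathcal X\times\mathcal Y$, and a sequence $z\in\mathcal Z^n$, fixed in advance. "$|\mathcal L|=m$" means that $\mathcal F$ has $m$ elements whose $m$ loss functions $\ell_f$ are distinct. A (randomized) selective learning algorithm is given $n$ and the model class, and observes $z_1,z_2,\dots$ one by one. At some time $t\in\{0,\dots,n-1\}$ of its choosing, having seen only $z_1,\dots,z_t$, it must stop and choose a window length $w\in\{1,\dots,n-t\}$ and a model $\hat\ell\in\mathcal L$. Its excess risk is $$\frac1w\sum_{i=1}^w\hat\ell(z_{t+i})-\inf_{\ell\in\mathcal L}\frac1w\sum_{i=1}^w\ell(z_{t+i}).$$ The algorithm is *non-adaptive* if it decides the window (i.e. $t$ and $w$) before seeing the data sequence, using only the model class and its own randomness. Expectations are over the randomness of the algorithm. For $n\ge1$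 and $m\ge2$ put $R(n,m)=\min\left\{\frac{\max\{1,\ \log\log m\}}{\log n},\,1\right\}$, with $R(1,m)=1$ (natural logarithms). **Theorem.** There is an absolute constant $c>0$ such that the following hold. 1. For all $n\ge1$, $m\ge2$ and every non-adaptive selective learning algorithm, there is a selective learning instance with $|\mathcal L|=m$ and sequence length $n$ on which the expected excess risk of the algorithm is at least $c\,R(n,m)$. 2. Let $g:\mathbb N\to\mathbb R$ satisfy $g(n)=\omega(\log\log n)$, i.e. $g(n)/\log\log n\to+\infty$. Then there is $n_0=n_0(g)$ such that for all $n\ge \max\{n_0,1\}$, all $m\ge2$ with $m\ge n^{g(n)}$ and every (possibly adaptive) selective learning algorithm, there is an instance with $|\mathcal L|=m$ and sequence length $n$ on which the expected excess risk of the algorithm is at least $c\,R(n,m)$. Moreover, the same holds for all $n\ge1$ and $m\ge 2$ with $m\ge n^{g(n)}$, if $c$ is replaced by a constant $c'>0$ that depends only on $g$. -/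

import Mathlib

open Filter MeasureTheory

universe u

namespace SelectiveLearning

/-- A finite nonempty class of models `f : X → Y`, with a loss function valued in `[0, 1]`. -/
structure ModelClass where
  X : Type
  Y : Type
  /-- `loss yhat y` is the loss for predicting `yhat` when the true label is `y`. -/
  loss : Y → Y → ℝ
  loss_mem : ∀ yhat y, loss yhat y ∈ Set.Icc (0 : ℝ) 1
  models : Finset (X → Y)
  models_nonempty : models.Nonempty

namespace ModelClass

/-- Labeled data points. -/
abbrev Z (C : ModelClass) : Type := C.X × C.Y

/-- The function from labeled data to losses that corresponds to a model. -/
def lossOf (C : ModelClass) (f : C.X → C.Y) (p : C.Z) : ℝ := C.loss (f p.1) p.2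

/-- The model class, viewed as a family of functions from labeled data to losses. -/
def lossFamily (C : ModelClass) : Set (C.Z → ℝ) := C.lossOf '' (C.models : Set (C.X → C.Y))

/-- The class has exactly `m` elements, both as a set of models and as a family of loss
functions. -/
def HasSize (C : ModelClass) (m : ℕ) : Prop :=
  C.models.card = m ∧ C.lossFamily.ncard = m

end ModelClass

/-- A prediction window for sequences of length `n`: after the first `start` data points, the next
`len ≥ 1` data points. (With data points indexed from `0`, these are the points
`start, …, start + len - 1`.) -/
structure Window (n : ℕ) where
  start : ℕ
  len : ℕ
  len_pos : 1 ≤ len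
  le_length : start + len ≤ n

/-- The average loss of the model `f` on the data points of the window `W`. -/
noncomputable def averageLoss (C : ModelClass) {n : ℕ} (z : Fin n → C.Z) (W : Window n)
    (f : C.X → C.Y) : ℝ :=
  (∑ i : Fin W.len,
    C.lossOf f (z ⟨W.start + i, lt_of_lt_of_le (Nat.add_lt_add_left i.2 _) W.le_length⟩)) / W.len

/-- The excess risk incurred by choosing the window `W` and the model `f` on the data `z`. -/
noncomputable def excessRisk (C : ModelClass) {n : ℕ} (z : Fin n → C.Z) (W : Window n)
    (f : C.X → C.Y) : ℝ :=
  averageLoss C z W f - ⨅ g : {g // g ∈ C.models}, averageLoss C z W g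

/-- A (randomized) selective learner for the model class `C` and sequences of length `n`.
The randomness of the learner is a seed `ω`, drawn from a probability space independently of the
data. Given the seed, on the data sequence `z`, the learner stops after the first
`(window ω z).start` data points, and commits to the window `window ω z` and the
model `model ω z` of the class. -/
structure Learner (C : ModelClass) (n : ℕ) where
  Seed : Type u
  [measurableSpace : MeasurableSpace Seed]
  law : Measure Seed
  [isProbabilityMeasure : IsProbabilityMeasure law]
  window : Seed → (Fin n → C.Z) → Window n
  model : Seed → (Fin n → C.Z) → {f // f ∈ C.models}
  /-- The learner sees the data points one by one: its stopping at time `t`, and its action at that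
  time, depend on the first `t` data points only. -/
  online : ∀ (ω : Seed) (z z' : Fin n → C.Z),
    (∀ i : Fin n, (i : ℕ) < (window ω z).start → z' i = z i) →
      window ω z' = window ω z ∧ model ω z' = model ω z
  measurableSet_action : ∀ (z : Fin n → C.Z) (W : Window n) (f : {f // f ∈ C.models}),
    MeasurableSet {ω | window ω z = W ∧ model ω z = f}

namespace Learner

variable {C : ModelClass} {n : ℕ}

/-- The learner decides the prediction window before seeing the data (from its seed alone). -/
def IsNonAdaptive (A : Learner.{u} C n) : Prop :=
  ∀ (ω : A.Seed) (z z' : Fin n → C.Z), A.window ω z = A.window ω z'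

/-- The expected excess risk of the learner on the fixed data sequence `z`. -/
noncomputable def expectedExcessRisk (A : Learner.{u} C n) (z : Fin n → C.Z) : ℝ :=
  letI := A.measurableSpace
  ∫ ω, excessRisk C z (A.window ω z) (A.model ω z) ∂A.law

end Learner

/-- A selective learning algorithm for sequences of length `n`: it takes a model class as its
input, and then runs as a selective learner for that class. -/
def Algorithm (n : ℕ) : Type (max 1 (u + 1)) := ∀ C : ModelClass, Learner.{u} C n

/-- On every model class, the algorithm decides the prediction window before seeing the data. -/
def Algorithm.IsNonAdaptive {n : ℕ} (A : Algorithm.{u} n) : Prop :=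
  ∀ C : ModelClass, (A C).IsNonAdaptive

/-- `min {log log m / log n, 1}`, where `log log m` is replaced by `1` if it is smaller than `1`,
and where the quotient counts as `+∞` if `n = 1`. -/
noncomputable def rate (n m : ℕ) : ℝ :=
  if n = 1 then 1 else min (max 1 (Real.log (Real.log m)) / Real.log n) 1

/-- There is an instance (a model class of size `m` and a data sequence of length `n`) on which
the expected excess risk of the algorithm is at least `r`. -/
def Algorithm.HasHardInstance {n : ℕ} (A : Algorithm.{u} n) (m : ℕ) (r : ℝ) : Prop :=
  ∃ C : ModelClass, C.HasSize m ∧ ∃ z : Fin n → C.Z, r ≤ (A C).expectedExcessRisk z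

end SelectiveLearning

/-! By averaging (Yao's principle), it suffices to find a finite family of data sequences on which
every deterministic learner has large average excess risk. Labels are constant on blocks, with
independent fair bits for the blocks, and the features reveal only the block index modulo `D`. When
a window contains many points of unseen blocks, but few enough blocks for their residues to be
distinct, some comparator knows all these labels, while the learner can only guess. Formally,
flipping all unseen labels preserves the learner's action and makes its two losses on each unseen
point add up to 1 (`le_excessRisk_add_excessRisk_flipFresh`, `le_sum_excessRisk`).

The block length must fit the window length up to a factor of order `D`, so about `log n / log D`
scales cover all windows (`exists_scale`, `challenging_shiftedBlock`). A non-adaptive learner cannot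
react to a random scale, which is right with probability one over the number of scales; `D` may be
as large as `Nat.log 2 m`. Against an adaptive learner all scales are present at once, one per
channel, and the loss averages over the channels. Some channel always fits. On the others the
comparator is constant and copies the learner's prediction on the block in progress, so that these
channels cancel. The constants multiply the size of the class by `2 ^ S`, whence the need for `m` to
be a large power of `n`. -/

namespace SelectiveLearning

/-! ### Averaging over a finite family of data sequences -/

section Averaging

variable {C : ModelClass} {n : ℕ}

instance : Finite (Window n) :=
  Finite.of_injective (β := Fin (n + 1) × Fin (n + 1))
    (fun W => (⟨W.start, by have := W.le_length; omega⟩, ⟨W.len, by have := W.le_length; omega⟩))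
    (by
      rintro ⟨a, b, _, _⟩ ⟨c, d, _, _⟩ h
      simp only [Prod.mk.injEq, Fin.mk.injEq] at h
      obtain ⟨rfl, rfl⟩ := h
      rfl)

theorem le_excessRisk (z : Fin n → C.Z) (W : Window n) (f : C.X → C.Y) {g : C.X → C.Y}
    (hg : g ∈ C.models) : averageLoss C z W f - averageLoss C z W g ≤ excessRisk C z W f := by
  unfold excessRisk
  have := ciInf_le (f := fun g : {g // g ∈ C.models} => averageLoss C z W g)
    (Set.finite_range _).bddBelow ⟨g, hg⟩
  simp only at this
  linarith

theorem excessRisk_nonneg (z : Fin n → C.Z) (W : Window n) {f : C.X → C.Y}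
    (hf : f ∈ C.models) : 0 ≤ excessRisk C z W f := by
  simpa using le_excessRisk z W f hf

theorem Learner.integrable_excessRisk (A : Learner.{u} C n) (z : Fin n → C.Z) :
    letI := A.measurableSpace
    Integrable (fun ω => excessRisk C z (A.window ω z) (A.model ω z)) A.law := by
  let _ := A.measurableSpace
  have := A.isProbabilityMeasure
  let act : A.Seed → Window n × {f // f ∈ C.models} := fun ω => (A.window ω z, A.model ω z)
  let risk : Window n × {f // f ∈ C.models} → ℝ := fun p => excessRisk C z p.1 p.2
  let _ : MeasurableSpace (Window n × {f // f ∈ C.models}) := ⊤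
  have hact : Measurable act := by
    refine measurable_to_countable' fun p => ?_
    have : act ⁻¹' {p} = {ω | A.window ω z = p.1 ∧ A.model ω z = p.2} := by
      ext ω
      simp [act, Prod.ext_iff]
    rw [this]
    exact A.measurableSet_action z p.1 p.2
  have hrisk : Measurable risk := fun _ _ => trivial
  obtain ⟨b, hb⟩ := (Set.finite_range fun p => ‖risk p‖).bddAbove
  exact Integrable.of_bound (hrisk.comp hact).aestronglyMeasurable b
    (ae_of_all _ fun ω => hb ⟨act ω, rfl⟩)

/-- A bound on the average over the family for each fixed seed survives integration over seeds, and
some member is at least the average. -/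
theorem Learner.exists_le_expectedExcessRisk (A : Learner.{u} C n) {I : Type*} [Fintype I]
    [Nonempty I] (z : I → Fin n → C.Z) (r : ℝ)
    (h : ∀ ω, Fintype.card I * r ≤
      ∑ i, excessRisk C (z i) (A.window ω (z i)) (A.model ω (z i))) :
    ∃ i, r ≤ A.expectedExcessRisk (z i) := by
  let _ := A.measurableSpace
  have := A.isProbabilityMeasure
  have hsum : Fintype.card I * r ≤ ∑ i, A.expectedExcessRisk (z i) := by
    unfold Learner.expectedExcessRisk
    rw [← integral_finsetSum _ fun i _ => A.integrable_excessRisk (z i)]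
    calc Fintype.card I * r = ∫ _, Fintype.card I * r ∂A.law := by simp
      _ ≤ _ := integral_mono (integrable_const _)
          (integrable_finsetSum _ fun i _ => A.integrable_excessRisk (z i)) h
  have hsum' : ∑ _i : I, r ≤ ∑ i, A.expectedExcessRisk (z i) := by simpa using hsum
  obtain ⟨i, -, hi⟩ := Finset.exists_le_of_sum_le Finset.univ_nonempty hsum'
  exact ⟨i, hi⟩

end Averaging

/-! ### Model classes that predict several binary channels -/

section Channels

variable {S : ℕ}

/-- `1` for a wrong prediction of a bit, `0` for a correct one. -/
def bitLoss (a b : Bool) : ℝ := if a = b then 0 else 1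

theorem bitLoss_nonneg (a b : Bool) : 0 ≤ bitLoss a b := by unfold bitLoss; split_ifs <;> norm_num

theorem bitLoss_le_one (a b : Bool) : bitLoss a b ≤ 1 := by unfold bitLoss; split_ifs <;> norm_num

@[simp] theorem bitLoss_self (a : Bool) : bitLoss a a = 0 := by simp [bitLoss]

theorem bitLoss_add_bitLoss_not (a b : Bool) : bitLoss a b + bitLoss a (!b) = 1 := by
  cases a <;> cases b <;> simp [bitLoss]

/-- The fraction of channels on which two vectors of bits differ. -/
noncomputable def hammingLoss (a b : Fin S → Bool) : ℝ := (∑ s, bitLoss (a s) (b s)) / S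

theorem hammingLoss_mem (a b : Fin S → Bool) : hammingLoss a b ∈ Set.Icc (0 : ℝ) 1 := by
  refine ⟨div_nonneg (Finset.sum_nonneg fun s _ => bitLoss_nonneg _ _) (Nat.cast_nonneg _),
    div_le_one_of_le₀ ?_ (Nat.cast_nonneg _)⟩
  simpa using Finset.sum_le_sum fun s (_ : s ∈ Finset.univ) => bitLoss_le_one (a s) (b s)

theorem eq_of_hammingLoss_eq_zero {a b : Fin S → Bool} (h : hammingLoss a b = 0) : a = b := by
  funext s
  have hS : (S : ℝ) ≠ 0 := by
    have := s.pos
    positivity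
  have h0 : ∑ s, bitLoss (a s) (b s) = 0 := by
    simpa [hammingLoss, hS] using h
  have := (Finset.sum_eq_zero_iff_of_nonneg fun s _ => bitLoss_nonneg _ _).1 h0 s
    (Finset.mem_univ s)
  by_contra hne
  simp [bitLoss, hne] at this

/-- The model that predicts each channel from the corresponding coordinate. -/
def channelwise (F : Fin S → ℕ → Bool) (x : Fin S → ℕ) (s : Fin S) : Bool := F s (x s)

theorem channelwise_injective : Function.Injective (channelwise (S := S)) := by
  intro F G h
  funext s k
  exact congrFun (congrFun h fun _ => k) s

/-- The class of the channelwise models given by a finite set of predictors. -/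
noncomputable abbrev channelClass (T : Finset (Fin S → ℕ → Bool)) (hT : T.Nonempty) :
    ModelClass where
  X := Fin S → ℕ
  Y := Fin S → Bool
  loss := hammingLoss
  loss_mem := hammingLoss_mem
  models := T.map ⟨channelwise, channelwise_injective⟩
  models_nonempty := hT.map

theorem hasSize_channelClass (T : Finset (Fin S → ℕ → Bool)) (hT : T.Nonempty) :
    (channelClass T hT).HasSize T.card := by
  refine ⟨Finset.card_map _, ?_⟩
  have hinj : Function.Injective (channelClass T hT).lossOf := by
    intro f g h
    funext x
    -- At the label `g x` the loss of `g` vanishes, which forces `f x = g x`.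
    have hx : hammingLoss (f x) (g x) = hammingLoss (g x) (g x) := congrFun h (x, g x)
    exact eq_of_hammingLoss_eq_zero (by rw [hx]; simp [hammingLoss])
  unfold ModelClass.lossFamily
  rw [Set.ncard_image_of_injective _ hinj, Set.ncard_coe_finset]
  exact Finset.card_map _

/-- The predictor that answers by membership in `P` on the channel `s`, and by a constant on each
of the other channels. -/
def comparator (s : Fin S) (P : Finset ℕ) (q : Fin S → Bool) (j : Fin S) (k : ℕ) : Bool :=
  if j = s then decide (k ∈ P) else q j

open Classical in
/-- The comparators with a set of integers less than `D`. -/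
noncomputable def comparators (S D : ℕ) : Finset (Fin S → ℕ → Bool) :=
  (Finset.univ ×ˢ (Finset.range D).powerset ×ˢ Finset.univ).image
    fun a : Fin S × Finset ℕ × (Fin S → Bool) => comparator a.1 a.2.1 a.2.2

theorem comparator_mem_comparators {D : ℕ} (s : Fin S) {P : Finset ℕ} (hP : P ⊆ Finset.range D)
    (q : Fin S → Bool) : comparator s P q ∈ comparators S D := by
  classical
  exact Finset.mem_image.2 ⟨(s, P, q), by simp [hP], rfl⟩

theorem card_comparators_le (S D : ℕ) : (comparators S D).card ≤ S * (2 ^ D * 2 ^ S) := by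
  classical
  refine Finset.card_image_le.trans ?_
  simp [Finset.card_product]

/-- A single channel leaves no room for the constants, so the factors `S * 2 ^ S` disappear and `D =
Nat.log 2 m` is affordable for every `m ≥ 2`. -/
theorem card_comparators_one_le (D : ℕ) : (comparators 1 D).card ≤ 2 ^ D := by
  classical
  have : comparators 1 D ⊆
      (Finset.range D).powerset.image fun P => comparator 0 P fun _ => false := by
    intro F hF
    obtain ⟨⟨s, P, q⟩, h, rfl⟩ := Finset.mem_image.1 hF
    refine Finset.mem_image.2 ⟨P, (Finset.mem_product.1 (Finset.mem_product.1 h).2).1, ?_⟩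
    funext s' k
    simp [comparator, Subsingleton.elim s' s, Subsingleton.elim 0 s]
  refine (Finset.card_le_card this).trans (Finset.card_image_le.trans ?_)
  simp

/-- Padding to size exactly `m` is harmless: the lower bounds hold for any predictor the learner
picks and only need the comparators to be available. -/
theorem exists_superset_comparators {D m : ℕ} (hS : 0 < S) (h : (comparators S D).card ≤ m) :
    ∃ T : Finset (Fin S → ℕ → Bool), T.Nonempty ∧ comparators S D ⊆ T ∧ T.card = m := by
  have : Nonempty (Fin S) := ⟨⟨0, hS⟩⟩
  obtain ⟨T, hT, hm⟩ := Infinite.exists_superset_card_eq (comparators S D) m h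
  exact ⟨T, ⟨_, hT (comparator_mem_comparators ⟨0, hS⟩ (Finset.empty_subset _) fun _ => false)⟩,
    hT, hm⟩

end Channels

/-! ### Blockwise constant labels and the flipping argument. -/

section BlockData

variable {S n : ℕ}

/-- The data point number `i` of the window `W`. -/
def Window.pos (W : Window n) (i : Fin W.len) : Fin n :=
  ⟨W.start + i, lt_of_lt_of_le (Nat.add_lt_add_left i.2 _) W.le_length⟩

/-- The block `k` does not meet the first `t` data points. -/
def Fresh (blk : Fin n → Fin n) (t : ℕ) (k : Fin n) : Prop := ∀ i : Fin n, i < t → blk i ≠ k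

open Classical in
/-- At most a quarter of the window lies in blocks that started before the window, and no two
blocks that start in the window are congruent modulo `D`. -/
def Window.Challenging (D : ℕ) (blk : Fin n → Fin n) (W : Window n) : Prop :=
  (∀ i j : Fin W.len, Fresh blk W.start (blk (W.pos i)) → Fresh blk W.start (blk (W.pos j)) →
    (blk (W.pos i) : ℕ) % D = blk (W.pos j) % D → blk (W.pos i) = blk (W.pos j)) ∧
  4 * (Finset.univ.filter fun i : Fin W.len => ¬ Fresh blk W.start (blk (W.pos i))).card ≤ W.len

/-- On each channel, the data come in blocks, of which the index modulo `D` is observed in advance,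
and which share the label `B`. -/
def blockData (D : ℕ) (blk : Fin S → Fin n → Fin n) (B : Fin S → Fin n → Bool) (i : Fin n) :
    (Fin S → ℕ) × (Fin S → Bool) :=
  (fun s => blk s i % D, fun s => B s (blk s i))

open Classical in
/-- Flip the labels of the blocks that do not meet the first `t` data points. -/
noncomputable def flipFresh (blk : Fin S → Fin n → Fin n) (t : ℕ) (B : Fin S → Fin n → Bool)
    (s : Fin S) (k : Fin n) : Bool :=
  if Fresh (blk s) t k then !B s k else B s k

theorem flipFresh_flipFresh (blk : Fin S → Fin n → Fin n) (t : ℕ) (B : Fin S → Fin n → Bool) :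
    flipFresh blk t (flipFresh blk t B) = B := by
  funext s k
  unfold flipFresh
  split_ifs <;> simp

theorem blockData_flipFresh (D : ℕ) (blk : Fin S → Fin n → Fin n) {t : ℕ}
    (B : Fin S → Fin n → Bool) {i : Fin n} (hi : i < t) :
    blockData D blk (flipFresh blk t B) i = blockData D blk B i := by
  have (s : Fin S) : ¬ Fresh (blk s) t (blk s i) := fun h => h i hi rfl
  simp [blockData, flipFresh, this]

open Classical in
/-- The predictor that uses the true labels of the fresh blocks of the window on the channel `s`,
and agrees with `F` on the first data point of the window on the other channels. -/
noncomputable def truthComparator (D : ℕ) (blk : Fin S → Fin n → Fin n) (W : Window n) (s : Fin S)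
    (q : Fin S → Bool) (B : Fin S → Fin n → Bool) : Fin S → ℕ → Bool :=
  comparator s ((Finset.range D).filter fun k : ℕ => ∃ i : Fin W.len,
    Fresh (blk s) W.start (blk s (W.pos i)) ∧ (blk s (W.pos i) : ℕ) % D = k ∧
      B s (blk s (W.pos i)) = true) q

theorem truthComparator_mem (D : ℕ) (blk : Fin S → Fin n → Fin n) (W : Window n) (s : Fin S)
    (q : Fin S → Bool) (B : Fin S → Fin n → Bool) :
    truthComparator D blk W s q B ∈ comparators S D := by
  classical
  unfold truthComparator
  exact comparator_mem_comparators s (Finset.filter_subset _ _) q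

theorem truthComparator_of_ne {D : ℕ} {blk : Fin S → Fin n → Fin n} {W : Window n} {s s' : Fin S}
    (h : s' ≠ s) (q : Fin S → Bool) (B : Fin S → Fin n → Bool) (k : ℕ) :
    truthComparator D blk W s q B s' k = q s' := by
  simp [truthComparator, comparator, h]

theorem truthComparator_self {D : ℕ} (hD : 0 < D) {blk : Fin S → Fin n → Fin n} {W : Window n}
    {s : Fin S} (hW : W.Challenging D (blk s)) (q : Fin S → Bool) (B : Fin S → Fin n → Bool)
    {i : Fin W.len} (hi : Fresh (blk s) W.start (blk s (W.pos i))) :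
    truthComparator D blk W s q B s (blk s (W.pos i) % D) = B s (blk s (W.pos i)) := by
  have hmod := Nat.mod_lt (blk s (W.pos i) : ℕ) hD
  rw [Bool.eq_iff_iff]
  simp only [truthComparator, comparator, if_true, decide_eq_true_eq, Finset.mem_filter,
    Finset.mem_range, hmod, true_and]
  constructor
  · rintro ⟨j, hj, hk, hB⟩
    rwa [← hW.1 j i hj hi hk]
  · exact fun h => ⟨i, hi, rfl, h⟩

theorem averageLoss_channelClass (T : Finset (Fin S → ℕ → Bool)) (hT : T.Nonempty) (D : ℕ)
    (blk : Fin S → Fin n → Fin n) (B : Fin S → Fin n → Bool) (W : Window n)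
    (F : Fin S → ℕ → Bool) :
    averageLoss (channelClass T hT) (blockData D blk B) W (channelwise F) =
      (∑ i, ∑ s, bitLoss (F s (blk s (W.pos i) % D)) (B s (blk s (W.pos i)))) / (S * W.len) := by
  rw [← div_div, Finset.sum_div]
  rfl

/-- The left side is `len / 4` divided by `S * len`: channel `s` gains at least `len / 4` over the
two labelings together, and every other channel contributes exactly 0. -/
theorem le_excessRisk_add_excessRisk_flipFresh {T : Finset (Fin S → ℕ → Bool)} (hT : T.Nonempty)
    {D : ℕ} (hD : 0 < D) (hTD : comparators S D ⊆ T) {blk : Fin S → Fin n → Fin n}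
    (hblk : ∀ s, Monotone (blk s)) {W : Window n} {s : Fin S} (hW : W.Challenging D (blk s))
    (F : Fin S → ℕ → Bool) (B : Fin S → Fin n → Bool) :
    1 / (4 * S : ℝ) ≤
      excessRisk (channelClass T hT) (blockData D blk B) W (channelwise F) +
      excessRisk (channelClass T hT) (blockData D blk (flipFresh blk W.start B)) W
        (channelwise F) := by
  classical
  set B' := flipFresh blk W.start B with hB'
  let i₀ : Fin W.len := ⟨0, W.len_pos⟩
  let q : Fin S → Bool := fun s' => F s' (blk s' (W.pos i₀) % D)
  have hmem (B : Fin S → Fin n → Bool) :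
      channelwise (truthComparator D blk W s q B) ∈ (channelClass T hT).models :=
    Finset.mem_map_of_mem _ (hTD (truthComparator_mem D blk W s q B))
  refine le_trans ?_ (add_le_add (le_excessRisk (C := channelClass T hT) _ W _ (hmem B))
    (le_excessRisk (C := channelClass T hT) _ W _ (hmem B')))
  simp only [averageLoss_channelClass]
  rw [← sub_div, ← sub_div, ← add_div, ← Finset.sum_sub_distrib, ← Finset.sum_sub_distrib,
    ← Finset.sum_add_distrib]
  -- The gain is 1 at a fresh point of channel `s`, and at least -2 at a stale one, where each of
  -- the two comparators loses at most 1.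
  have hpoint (i : Fin W.len) : (1 : ℝ) -
      3 * (if ¬ Fresh (blk s) W.start (blk s (W.pos i)) then 1 else 0) ≤
      (∑ s', bitLoss (F s' (blk s' (W.pos i) % D)) (B s' (blk s' (W.pos i))) -
        ∑ s', bitLoss (truthComparator D blk W s q B s' (blk s' (W.pos i) % D))
          (B s' (blk s' (W.pos i)))) +
      (∑ s', bitLoss (F s' (blk s' (W.pos i) % D)) (B' s' (blk s' (W.pos i))) -
        ∑ s', bitLoss (truthComparator D blk W s q B' s' (blk s' (W.pos i) % D))
          (B' s' (blk s' (W.pos i)))) := by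
    rw [← Finset.sum_sub_distrib, ← Finset.sum_sub_distrib, ← Finset.sum_add_distrib,
      Finset.sum_eq_single_of_mem s (Finset.mem_univ s)]
    · by_cases hi : Fresh (blk s) W.start (blk s (W.pos i))
      · rw [truthComparator_self hD hW q B hi, truthComparator_self hD hW q B' hi]
        have : B' s (blk s (W.pos i)) = !B s (blk s (W.pos i)) := by simp [hB', flipFresh, hi]
        have h1 := bitLoss_add_bitLoss_not (F s (blk s (W.pos i) % D)) (B s (blk s (W.pos i)))
        simp only [hi, not_true_eq_false, if_false, bitLoss_self, this]
        linarith
      · simp only [hi, not_false_eq_true, if_true]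
        have h1 := bitLoss_nonneg (F s (blk s (W.pos i) % D)) (B s (blk s (W.pos i)))
        have h2 := bitLoss_nonneg (F s (blk s (W.pos i) % D)) (B' s (blk s (W.pos i)))
        have h3 := bitLoss_le_one (truthComparator D blk W s q B s (blk s (W.pos i) % D))
          (B s (blk s (W.pos i)))
        have h4 := bitLoss_le_one (truthComparator D blk W s q B' s (blk s (W.pos i) % D))
          (B' s (blk s (W.pos i)))
        linarith
    · intro s' _ hs'
      rw [truthComparator_of_ne hs', truthComparator_of_ne hs']
      by_cases hi : Fresh (blk s') W.start (blk s' (W.pos i))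
      · have : B' s' (blk s' (W.pos i)) = !B s' (blk s' (W.pos i)) := by simp [hB', flipFresh, hi]
        have h1 := bitLoss_add_bitLoss_not (F s' (blk s' (W.pos i) % D)) (B s' (blk s' (W.pos i)))
        have h2 := bitLoss_add_bitLoss_not (q s') (B s' (blk s' (W.pos i)))
        rw [this]
        linarith
      -- By monotonicity all stale points of the window lie in the block of its first point, where
      -- the constant `q s'` is the prediction of `F`.
      · have hsame : blk s' (W.pos i) = blk s' (W.pos i₀) := by
          unfold Fresh at hi
          push Not at hi
          obtain ⟨j, hj, hji⟩ := hi
          refine le_antisymm (hji ▸ hblk s' ?_) (hblk s' ?_)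
          · simp [Fin.le_def, Window.pos, i₀]
          · simpa [Fin.le_def, Window.pos, i₀] using hj.le
        simp only [hsame, q]
        linarith
  have hsum := Finset.sum_le_sum fun i (_ : i ∈ Finset.univ) => hpoint i
  rw [Finset.sum_sub_distrib, ← Finset.mul_sum, Finset.sum_boole] at hsum
  simp only [Finset.sum_const, Finset.card_univ, Fintype.card_fin, nsmul_eq_mul, mul_one] at hsum
  have hstale : (4 : ℝ) * (Finset.univ.filter fun i : Fin W.len =>
      ¬ Fresh (blk s) W.start (blk s (W.pos i))).card ≤ W.len := by exact_mod_cast hW.2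
  have hS : (0 : ℝ) < S := by exact_mod_cast s.pos
  have hlen : (0 : ℝ) < W.len := by exact_mod_cast W.len_pos
  rw [div_le_div_iff₀ (by positivity) (by positivity)]
  have := mul_le_mul_of_nonneg_left (hsum.trans' (show (W.len : ℝ) / 4 ≤ _ by linarith)) hS.le
  linarith

/-- If on every label sequence the window is challenging for some channel, the average excess risk
over all label sequences is at least `1 / (8 S)`. -/
theorem le_sum_excessRisk {T : Finset (Fin S → ℕ → Bool)} (hT : T.Nonempty)
    {D : ℕ} (hD : 0 < D) (hTD : comparators S D ⊆ T) {blk : Fin S → Fin n → Fin n}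
    (hblk : ∀ s, Monotone (blk s)) (A : Learner.{u} (channelClass T hT) n) (ω : A.Seed)
    (hW : ∀ B, ∃ s, (A.window ω (blockData D blk B)).Challenging D (blk s)) :
    Fintype.card (Fin S → Fin n → Bool) * (1 / (8 * S : ℝ)) ≤
      ∑ B, excessRisk (channelClass T hT) (blockData D blk B) (A.window ω (blockData D blk B))
        (A.model ω (blockData D blk B)) := by
  let flip (B : Fin S → Fin n → Bool) : Fin S → Fin n → Bool :=
    flipFresh blk (A.window ω (blockData D blk B)).start B
  have hsame (B : Fin S → Fin n → Bool) :
      A.window ω (blockData D blk (flip B)) = A.window ω (blockData D blk B) ∧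
      A.model ω (blockData D blk (flip B)) = A.model ω (blockData D blk B) :=
    A.online ω _ _ fun i hi => blockData_flipFresh D blk B hi
  -- The stopping time depends on `B`, but the flip leaves the data seen before it unchanged, so the
  -- second flip uses the same time.
  have hflip : Function.Involutive flip := fun B => by
    change flipFresh blk (A.window ω (blockData D blk (flip B))).start (flip B) = B
    rw [(hsame B).1]
    exact flipFresh_flipFresh _ _ _
  let e (B : Fin S → Fin n → Bool) : ℝ := excessRisk (channelClass T hT) (blockData D blk B)
    (A.window ω (blockData D blk B)) (A.model ω (blockData D blk B))
  have hpair (B : Fin S → Fin n → Bool) : 1 / (4 * S : ℝ) ≤ e B + e (flip B) := by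
    obtain ⟨s, hs⟩ := hW B
    obtain ⟨F, -, hF⟩ := Finset.mem_map.1 (A.model ω (blockData D blk B)).2
    have := le_excessRisk_add_excessRisk_flipFresh hT hD hTD hblk hs F B
    simp only [e, (hsame B).1, (hsame B).2, ← hF]
    exact this
  have hsum := Finset.sum_le_sum fun B (_ : B ∈ Finset.univ) => hpair B
  have hperm : ∑ B, e (flip B) = ∑ B, e B := Equiv.sum_comp hflip.toPerm e
  rw [Finset.sum_add_distrib, hperm, Finset.sum_const, Finset.card_univ, nsmul_eq_mul] at hsum
  have h48 : (1 / (4 * S : ℝ)) = 2 * (1 / (8 * S : ℝ)) := by ring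
  rw [h48] at hsum
  change _ ≤ ∑ B, e B
  linarith

/-- The index of the block of `i`, if the blocks have length `b` and are shifted by `o`. -/
def shiftedBlock (b o : ℕ) (ho : o < b) (i : Fin n) : Fin n :=
  ⟨(i + o) / b, by
    have : (i + o) / b < i + 1 := by
      rw [Nat.div_lt_iff_lt_mul (by omega)]
      nlinarith
    omega⟩

theorem monotone_shiftedBlock (b o : ℕ) (ho : o < b) :
    Monotone (shiftedBlock (n := n) b o ho) := fun _ _ hij =>
  Nat.div_le_div_right (Nat.add_le_add_right hij _)

/-- Here `τ` is a block boundary. Window points before `τ` share the block of the last observed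
point, so they are stale; those from `τ` on are fresh and lie in `D` consecutive blocks, whose
indices are distinct modulo `D`. -/
theorem challenging_shiftedBlock {D b o τ : ℕ} (ho : o < b) {W : Window n} (hτ : W.start ≤ τ)
    (hdvd : b ∣ τ + o) (hfirst : W.start < τ → 0 < W.start ∧ τ < W.start + b)
    (hquarter : 4 * (τ - W.start) ≤ W.len) (hend : W.start + W.len ≤ τ + b * D) :
    W.Challenging D (shiftedBlock b o ho) := by
  classical
  obtain ⟨c, hc⟩ := hdvd
  have hb : 0 < b := by omega
  have hstale (i : Fin W.len)
      (hi : Fresh (shiftedBlock b o ho) W.start (shiftedBlock b o ho (W.pos i))) :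
      τ ≤ W.start + i := by
    by_contra! hlt
    obtain ⟨h0, h1⟩ := hfirst (by omega)
    have hn := W.le_length
    have hl := W.len_pos
    refine hi ⟨W.start - 1, by omega⟩ (by simp only; omega) (Fin.ext ?_)
    simp only [shiftedBlock, Window.pos]
    have hc' : τ + o = b * (c - 1) + b := by
      obtain _ | c := c
      · omega
      · simpa [mul_add] using hc
    have key (k : ℕ) (hk : τ ≤ k + b) (hk' : k < τ) : (k + o) / b = c - 1 := by
      rw [Nat.div_eq_iff hb, mul_comm (c - 1)]
      omega
    rw [key _ (by omega) (by omega), key _ (by omega) hlt]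
  refine ⟨fun i j hi hj hij => Fin.ext ?_, ?_⟩
  · have key (k : Fin W.len) (hk : τ ≤ W.start + k) :
        c ≤ shiftedBlock b o ho (W.pos k) ∧ (shiftedBlock b o ho (W.pos k) : ℕ) < c + D := by
      simp only [shiftedBlock, Window.pos]
      rw [Nat.le_div_iff_mul_le hb, Nat.div_lt_iff_lt_mul hb]
      have := k.2
      constructor <;> nlinarith
    have h1 := key i (hstale i hi)
    have h2 := key j (hstale j hj)
    refine Nat.ModEq.eq_of_abs_lt hij ?_
    rw [abs_lt]
    constructor <;> omega
  · refine le_trans (Nat.mul_le_mul_left 4 ?_) hquarter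
    have hsub : (Finset.univ.filter fun i : Fin W.len =>
        ¬ Fresh (shiftedBlock b o ho) W.start (shiftedBlock b o ho (W.pos i))).map
          Fin.valEmbedding ⊆ Finset.range (τ - W.start) := by
      intro k hk
      obtain ⟨i, hi, rfl⟩ := Finset.mem_map.1 hk
      simp only [Finset.mem_filter, Finset.mem_univ, true_and] at hi
      by_contra hge
      simp only [Fin.valEmbedding_apply, Finset.mem_range, not_lt] at hge
      refine hi fun j hj heq => ?_
      have h1 : (shiftedBlock b o ho j : ℕ) < c := by
        simp only [shiftedBlock]
        rw [Nat.div_lt_iff_lt_mul hb]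
        nlinarith
      have h2 : c ≤ (shiftedBlock b o ho (W.pos i) : ℕ) := by
        simp only [shiftedBlock, Window.pos]
        rw [Nat.le_div_iff_mul_le hb]
        have : τ ≤ W.start + i := by omega
        nlinarith
      rw [heq] at h1
      omega
    simpa using Finset.card_le_card hsub

end BlockData

/-! ### The three families of hard instances. -/

section HardInstances

variable {n m : ℕ}

theorem exists_aligned {b : ℕ} (hb : 0 < b) (t : ℕ) :
    ∃ c, t ≤ c * b ∧ c * b < t + b ∧ (t < c * b → 0 < t) := by
  refine ⟨(t + b - 1) / b, ?_, ?_, ?_⟩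
  · have := Nat.lt_div_mul_add (a := t + b - 1) hb
    omega
  · have := Nat.div_mul_le_self (t + b - 1) b
    omega
  · intro h
    by_contra! h0
    obtain rfl : t = 0 := by omega
    rw [Nat.div_eq_of_lt (by omega)] at h
    omega

/-- Rounding the start up to a multiple of `r ^ k` then costs at most a quarter of the window; if `r
^ k = 1` it costs nothing, which covers the windows too short for the first alternative. -/
theorem exists_scale {r n : ℕ} (hr : 2 ≤ r) (W : Window n) :
    ∃ k : Fin (Nat.log r n + 1), W.len < 4 * r * r ^ (k : ℕ) ∧
      (4 * r ^ (k : ℕ) ≤ W.len ∨ r ^ (k : ℕ) = 1) := by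
  have hle : W.len / 4 ≤ n := by have := W.le_length; omega
  refine ⟨⟨Nat.log r (W.len / 4), Nat.lt_succ_of_le (Nat.log_mono_right hle)⟩, ?_, ?_⟩
  · have := Nat.lt_pow_succ_log_self (b := r) (by omega) (W.len / 4)
    rw [pow_succ'] at this
    simp only
    rw [mul_assoc]
    omega
  · by_cases h0 : W.len / 4 = 0
    · right
      simp [h0]
    · left
      have := Nat.pow_log_le_self r h0
      simp only
      omega

theorem Algorithm.hasHardInstance_of_isNonAdaptive (hm : 2 ≤ m) (A : Algorithm.{u} n)
    (hA : A.IsNonAdaptive) :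
    A.HasHardInstance m (1 / (64 * ((Nat.log (2 * Nat.log 2 m) n : ℝ) + 1))) := by
  set D := Nat.log 2 m with hD
  have hD1 : 0 < D := Nat.log_pos (by norm_num) hm
  set K := Nat.log (2 * D) n + 1 with hK
  obtain ⟨T, hT, hTD, rfl⟩ := exists_superset_comparators (S := 1) (D := D) (m := m) one_pos
    ((card_comparators_one_le D).trans (Nat.pow_log_le_self 2 (by omega)))
  refine ⟨channelClass T hT, hasSize_channelClass T hT, ?_⟩
  have hβ (k : ℕ) : 0 < (2 * D) ^ k := by positivity
  -- Blocks of 8 units with a random offset keep the base `2 * D` at least 2 even when `D = 1`,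
  -- since `4 * (2 * D)` units are just `D` blocks. The offset, one of 8, puts a block boundary at
  -- the first unit boundary from the window start on.
  let blk (k : Fin K) (o : Fin 8) (_ : Fin 1) : Fin n → Fin n :=
    shiftedBlock (8 * (2 * D) ^ (k : ℕ)) (o * (2 * D) ^ (k : ℕ))
      (Nat.mul_lt_mul_of_pos_right o.2 (hβ k))
  have hblk (k o s) : Monotone (blk k o s) := monotone_shiftedBlock _ _ _
  let z (p : (Fin K × Fin 8) × (Fin 1 → Fin n → Bool)) : Fin n → (channelClass T hT).Z :=
    blockData D (blk p.1.1 p.1.2) p.2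
  suffices h : ∃ i, 1 / (64 * ((Nat.log (2 * D) n : ℝ) + 1)) ≤
      (A (channelClass T hT)).expectedExcessRisk (z i) from h.imp' _ fun _ => id
  refine (A (channelClass T hT)).exists_le_expectedExcessRisk z _ fun ω => ?_
  set W := (A (channelClass T hT)).window ω (z ((0, 0), fun _ _ => false))
  obtain ⟨k, hk, hk'⟩ := exists_scale (r := 2 * D) (by omega) W
  obtain ⟨c, hc, hc', hc0⟩ := exists_aligned (hβ k) W.start
  have hWc (o : Fin 8) (ho : 8 ∣ c + o) (s : Fin 1) : W.Challenging D (blk k o s) := by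
    refine challenging_shiftedBlock (τ := c * (2 * D) ^ (k : ℕ)) _ hc ?_ ?_ ?_ ?_
    · rw [← add_mul]
      exact Nat.mul_dvd_mul_right ho _
    · intro h
      exact ⟨hc0 h, by omega⟩
    · omega
    · have : 4 * (2 * D) * (2 * D) ^ (k : ℕ) = 8 * (2 * D) ^ (k : ℕ) * D := by ring
      omega
  let o : Fin 8 := ⟨(8 - c % 8) % 8, Nat.mod_lt _ (by norm_num)⟩
  have ho : 8 ∣ c + o := by simp only [o]; omega
  have hsum := le_sum_excessRisk hT hD1 hTD (hblk k o) (A (channelClass T hT)) ω fun B =>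
    ⟨0, by rw [hA _ ω _ (z ((0, 0), fun _ _ => false))]; exact hWc o ho 0⟩
  rw [Fintype.sum_prod_type]
  -- Only the fitting pair is kept, a fraction `1 / (8 * K)` of the family, with average risk at
  -- least `1 / 8`.
  refine le_trans ?_ (Finset.single_le_sum (a := ((k, o) : Fin K × Fin 8))
    (fun i _ => Finset.sum_nonneg fun B _ => excessRisk_nonneg _ _ (Subtype.prop _))
    (Finset.mem_univ _))
  refine le_trans (le_of_eq ?_) hsum
  simp only [Fintype.card_prod, Fintype.card_fin, hK]
  push_cast
  field_simp
  norm_num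

theorem Algorithm.hasHardInstance_of_mul_pow_le {r : ℕ} (hr : 2 ≤ r)
    (hm : (Nat.log r n + 1) * (2 ^ (4 * r) * 2 ^ (Nat.log r n + 1)) ≤ m) (A : Algorithm.{u} n) :
    A.HasHardInstance m (1 / (8 * ((Nat.log r n : ℝ) + 1))) := by
  set S := Nat.log r n + 1 with hS
  obtain ⟨T, hT, hTD, rfl⟩ := exists_superset_comparators (S := S) (D := 4 * r) (m := m)
    (Nat.succ_pos _) ((card_comparators_le _ _).trans hm)
  refine ⟨channelClass T hT, hasSize_channelClass T hT, ?_⟩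
  let blk (s : Fin S) : Fin n → Fin n := shiftedBlock (r ^ (s : ℕ)) 0 (by positivity)
  suffices h : ∃ B, 1 / (8 * ((Nat.log r n : ℝ) + 1)) ≤
      (A (channelClass T hT)).expectedExcessRisk (blockData (4 * r) blk B) from
    h.imp' _ fun _ => id
  refine (A (channelClass T hT)).exists_le_expectedExcessRisk (blockData (4 * r) blk) _ fun ω => ?_
  have hsum := le_sum_excessRisk hT (by omega) hTD (fun s => monotone_shiftedBlock _ _ _)
    (A (channelClass T hT)) ω (blk := blk) fun B => by
      set W := (A (channelClass T hT)).window ω (blockData (4 * r) blk B)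
      obtain ⟨k, hk, hk'⟩ := exists_scale hr W
      obtain ⟨c, hc, hc', hc0⟩ := exists_aligned (b := r ^ (k : ℕ)) (by positivity) W.start
      -- The scale `k` of the window serves as the channel, so the window may depend on the data.
      refine ⟨k, challenging_shiftedBlock (τ := c * r ^ (k : ℕ)) _ hc (by simp)
        (fun h => ⟨hc0 h, hc'⟩) (by omega) ?_⟩
      have : 4 * r * r ^ (k : ℕ) = r ^ (k : ℕ) * (4 * r) := by ring
      omega
  refine le_trans (le_of_eq ?_) hsum
  simp [hS]

/-- After the learner has committed itself, all further labels can be the ones that its model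
does not predict. -/
theorem Algorithm.hasHardInstance_one_div_two_pow (hm : 2 ≤ m) (A : Algorithm.{u} n) :
    A.HasHardInstance m (1 / 2 ^ n) := by
  obtain ⟨T, hT, hTD, rfl⟩ := exists_superset_comparators (S := 1) (D := 1) (m := m) one_pos
    ((card_comparators_one_le 1).trans (by simpa using hm))
  refine ⟨channelClass T hT, hasSize_channelClass T hT, ?_⟩
  let blk (_ : Fin 1) : Fin n → Fin n := id
  suffices h : ∃ B, 1 / 2 ^ n ≤
      (A (channelClass T hT)).expectedExcessRisk (blockData 1 blk B) from h.imp' _ fun _ => id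
  refine (A (channelClass T hT)).exists_le_expectedExcessRisk (blockData 1 blk) _ fun ω => ?_
  let z₀ : Fin n → (channelClass T hT).Z := blockData 1 blk fun _ _ => false
  obtain ⟨F, -, hF⟩ := Finset.mem_map.1 ((A (channelClass T hT)).model ω z₀).2
  let W := (A (channelClass T hT)).window ω z₀
  let B (_ : Fin 1) (k : Fin n) : Bool := if (k : ℕ) < W.start then false else !F 0 0
  have hsame := (A (channelClass T hT)).online ω z₀ (blockData 1 blk B) fun i hi => by
    have hi' : (i : ℕ) < W.start := hi
    simp [z₀, blockData, blk, B, hi']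
  -- With `D = 1` the only feature value is 0, and this set encodes the constant prediction `!F 0
  -- 0`.
  let P : Finset ℕ := if F 0 0 then ∅ else {0}
  have hP : P ⊆ Finset.range 1 := by
    simp only [P]
    split_ifs <;> simp
  have hB (i : Fin W.len) : B 0 (W.pos i) = !F 0 0 := by simp [B, Window.pos]
  have hone : 1 ≤ excessRisk (channelClass T hT) (blockData 1 blk B) W (channelwise F) := by
    refine le_trans ?_ (le_excessRisk (C := channelClass T hT) _ W _
      (Finset.mem_map_of_mem _ (hTD (comparator_mem_comparators 0 hP fun _ => false))))
    change _ ≤ averageLoss (channelClass T hT) (blockData 1 blk B) W (channelwise F) -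
      averageLoss (channelClass T hT) (blockData 1 blk B) W
        (channelwise (comparator 0 P fun _ => false))
    rw [averageLoss_channelClass, averageLoss_channelClass]
    have hlen : (W.len : ℝ) ≠ 0 := by
      have := W.len_pos
      positivity
    have h1 : bitLoss (F 0 0) (!F 0 0) = 1 := by cases F 0 0 <;> simp [bitLoss]
    have h2 : bitLoss (comparator (S := 1) 0 P (fun _ => false) 0 0) (!F 0 0) = 0 := by
      cases h : F 0 0 <;> simp [bitLoss, comparator, P, h]
    simp [blk, hB, Nat.mod_one, h1, h2, hlen]
  -- The bad labeling depends on the seed, so it counts as one of `2 ^ n` equally weighted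
  -- labelings.
  refine le_trans ?_ (Finset.single_le_sum (a := B)
    (fun i _ => excessRisk_nonneg _ _ (Subtype.prop _)) (Finset.mem_univ _))
  rw [hsame.1, hsame.2, ← hF]
  refine le_trans (le_of_eq ?_) hone
  simp

theorem Algorithm.HasHardInstance.mono {A : Algorithm.{u} n} {r r' : ℝ}
    (h : A.HasHardInstance m r) (hr : r' ≤ r) : A.HasHardInstance m r' := by
  obtain ⟨C, hC, z, hz⟩ := h
  exact ⟨C, hC, z, hr.trans hz⟩

end HardInstances

/-! ### Comparing the number of scales with the rate. -/

section Rate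

variable {n m : ℕ}

theorem rate_le_one (n m : ℕ) : rate n m ≤ 1 := by
  unfold rate
  split_ifs
  · exact le_rfl
  · exact min_le_right _ _

theorem rate_nonneg (n m : ℕ) : 0 ≤ rate n m := by
  unfold rate
  split_ifs
  · exact zero_le_one
  · have : (0 : ℝ) ≤ max 1 (Real.log (Real.log m)) := le_max_of_le_left zero_le_one
    have := Real.log_natCast_nonneg n
    positivity

theorem rate_mul_log_le (n m : ℕ) : rate n m * Real.log n ≤ max 1 (Real.log (Real.log m)) := by
  have hM : (0 : ℝ) ≤ max 1 (Real.log (Real.log m)) := le_max_of_le_left zero_le_one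
  unfold rate
  split_ifs with h
  · simp [h]
  · rcases (Real.log_natCast_nonneg n).eq_or_lt with h0 | h0
    · simp [← h0]
    · rw [← le_div_iff₀ h0]
      exact min_le_left _ _

/-- Since `Nat.log r n ≤ log n / log r`, a base with `log r` of order `max 1 (log log m)` makes the
number of scales at most of order `1 / rate n m`. -/
theorem rate_mul_natLog_add_one_le {r : ℕ} {a : ℝ} (hn : 1 ≤ n) (hr : 2 ≤ r) (ha : 0 ≤ a)
    (h : max 1 (Real.log (Real.log m)) ≤ a * Real.log r) :
    rate n m * ((Nat.log r n : ℝ) + 1) ≤ 1 + a := by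
  set M := max 1 (Real.log (Real.log m)) with hM
  have hM1 : 1 ≤ M := le_max_left _ _
  have hlog : (Nat.log r n : ℝ) * Real.log r ≤ Real.log n := by
    rw [← Real.log_pow]
    refine Real.log_le_log (by positivity) ?_
    exact_mod_cast Nat.pow_log_le_self r (by omega)
  have h1 : (Nat.log r n : ℝ) * M ≤ a * Real.log n := by
    calc (Nat.log r n : ℝ) * M ≤ Nat.log r n * (a * Real.log r) := by gcongr
      _ = a * (Nat.log r n * Real.log r) := by ring
      _ ≤ _ := by gcongr
  have h2 := rate_mul_log_le n m
  have h3 : rate n m * (Nat.log r n * M) ≤ a * M := by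
    calc rate n m * (Nat.log r n * M) ≤ rate n m * (a * Real.log n) :=
          mul_le_mul_of_nonneg_left h1 (rate_nonneg n m)
      _ = a * (rate n m * Real.log n) := by ring
      _ ≤ _ := by gcongr
  have h4 : rate n m * Nat.log r n ≤ a := by
    rw [← mul_assoc] at h3
    exact le_of_mul_le_mul_right h3 (by linarith)
  have := rate_le_one n m
  linarith

theorem rate_le_of_isNonAdaptive (hn : 1 ≤ n) (hm : 2 ≤ m) :
    1 / 192 * rate n m ≤ 1 / (64 * ((Nat.log (2 * Nat.log 2 m) n : ℝ) + 1)) := by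
  have hD1 : 0 < Nat.log 2 m := Nat.log_pos (by norm_num) hm
  set D := Nat.log 2 m with hD
  have hD1' : (1 : ℝ) ≤ D := by exact_mod_cast hD1
  have h2D : (2 : ℝ) ≤ ((2 * D : ℕ) : ℝ) := by exact_mod_cast (by omega : 2 ≤ 2 * D)
  have hlog2 := Real.log_two_gt_d9
  have hlog2' := Real.log_two_lt_d9
  have hlogD : Real.log 2 ≤ Real.log (2 * D : ℕ) := Real.log_le_log (by norm_num) h2D
  have hlogm : Real.log m ≤ (2 * D : ℕ) := by
    have : (m : ℝ) ≤ 2 ^ (D + 1) := by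
      exact_mod_cast (Nat.lt_pow_succ_log_self (by norm_num) m).le
    have := Real.log_le_log (by positivity) this
    rw [Real.log_pow] at this
    push_cast at this ⊢
    nlinarith
  have hm0 : 0 < Real.log m := Real.log_pos (by exact_mod_cast hm)
  have hloglog := Real.log_le_log hm0 hlogm
  -- With `a = 2` the constant is `64 * (1 + 2) = 192`.
  have := rate_mul_natLog_add_one_le (m := m) (r := 2 * D) (a := 2) hn (by omega) (by norm_num)
    (max_le (by linarith) (by linarith))
  rw [le_div_iff₀ (by positivity)]
  linarith

theorem exists_branching (hn : (100 : ℝ) ≤ Real.log n) (hm : 100 * Real.log n ≤ Real.log m) :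
    ∃ r : ℕ, 2 ≤ r ∧ (Nat.log r n + 1) * (2 ^ (4 * r) * 2 ^ (Nat.log r n + 1)) ≤ m ∧
      1 / 192 * rate n m ≤ 1 / (8 * ((Nat.log r n : ℝ) + 1)) := by
  set L := Real.log m with hL
  have hL0 : (10000 : ℝ) ≤ L := by linarith
  have hn0 : n ≠ 0 := by
    rintro rfl
    norm_num at hn
  have hm0 : (0 : ℝ) < m := by
    rcases Nat.eq_zero_or_pos m with rfl | h
    · norm_num [hL] at hL0
    · exact_mod_cast h
  -- The square root keeps `2 ^ (4 * r)` far below `m`, at the cost of only a constant factor in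
  -- `log r`.
  set r := ⌊√L⌋₊ with hr
  have hsq : √L * √L = L := Real.mul_self_sqrt (by linarith)
  have hs100 : 100 ≤ √L := Real.le_sqrt_of_sq_le (by linarith)
  have hrle : (r : ℝ) ≤ √L := Nat.floor_le (by positivity)
  have hrlt : √L < r + 1 := Nat.lt_floor_add_one _
  have hr99 : (99 : ℝ) ≤ r := by linarith
  have hr2 : 2 ≤ r := by
    have : (2 : ℝ) ≤ r := by linarith
    exact_mod_cast this
  have hr4 : L ≤ (r : ℝ) ^ 4 := by
    have h1 : √L ≤ (r : ℝ) ^ 2 := by nlinarith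
    calc L = √L * √L := hsq.symm
      _ ≤ (r : ℝ) ^ 2 * (r : ℝ) ^ 2 := by gcongr
      _ = (r : ℝ) ^ 4 := by ring
  have hloglog : Real.log L ≤ 4 * Real.log r := by
    have := Real.log_le_log (by linarith) hr4
    rwa [Real.log_pow] at this
  have hlogr : 1 ≤ Real.log r := by
    rw [Real.le_log_iff_exp_le (by linarith)]
    have := Real.exp_one_lt_d9
    linarith
  have hnat : (Nat.log r n : ℝ) ≤ Real.log n := by
    have h1 : (Nat.log r n : ℝ) * Real.log r ≤ Real.log n := by
      rw [← Real.log_pow]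
      refine Real.log_le_log (by positivity) ?_
      exact_mod_cast Nat.pow_log_le_self r hn0
    nlinarith [Nat.cast_nonneg (α := ℝ) (Nat.log r n)]
  refine ⟨r, hr2, ?_, ?_⟩
  · have h1 : (Nat.log r n + 1) * (2 ^ (4 * r) * 2 ^ (Nat.log r n + 1)) ≤
        2 ^ (4 * r + 2 * (Nat.log r n + 1)) := by
      calc (Nat.log r n + 1) * (2 ^ (4 * r) * 2 ^ (Nat.log r n + 1))
          ≤ 2 ^ (Nat.log r n + 1) * (2 ^ (4 * r) * 2 ^ (Nat.log r n + 1)) :=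
            Nat.mul_le_mul_right _ Nat.lt_two_pow_self.le
        _ = _ := by ring
    refine h1.trans ?_
    have h2 : ((2 : ℝ)) ^ (4 * r + 2 * (Nat.log r n + 1)) ≤ m := by
      rw [← Real.log_le_log_iff (by positivity) hm0, Real.log_pow]
      have hlog2' := Real.log_two_lt_d9
      have hlog2 := Real.log_two_gt_d9
      push_cast
      have : (4 * (r : ℝ) + 2 * (Nat.log r n + 1)) ≤ L := by nlinarith
      have h0 : 0 ≤ (4 * (r : ℝ) + 2 * (Nat.log r n + 1)) := by positivity
      nlinarith
    exact_mod_cast h2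
  · have := rate_mul_natLog_add_one_le (n := n) (m := m) (r := r) (a := 4) (by omega) hr2
      (by norm_num) (max_le (by linarith) hloglog)
    rw [le_div_iff₀ (by positivity)]
    linarith

theorem eventually_large_exponent {g : ℕ → ℝ}
    (hg : Tendsto (fun n : ℕ => g n / Real.log (Real.log (n : ℝ))) atTop atTop) :
    ∀ᶠ n : ℕ in atTop, 100 ≤ Real.log n ∧ 100 ≤ g n := by
  have hlog : Tendsto (fun n : ℕ => Real.log n) atTop atTop :=
    Real.tendsto_log_atTop.comp tendsto_natCast_atTop_atTop
  have hloglog := Real.tendsto_log_atTop.comp hlog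
  filter_upwards [hlog.eventually_ge_atTop 100, hloglog.eventually_ge_atTop 1,
    hg.eventually_ge_atTop 100] with n h1 h2 h3
  simp only [Function.comp_apply] at h2
  rw [le_div_iff₀ (by linarith)] at h3
  exact ⟨h1, by linarith⟩

end Rate

end SelectiveLearning

theorem theorem2 :
    ∃ c : ℝ, 0 < c ∧
      -- non-adaptive algorithms
      (∀ n m : ℕ, 1 ≤ n → 2 ≤ m → ∀ A : SelectiveLearning.Algorithm.{u} n, A.IsNonAdaptive →
        A.HasHardInstance m (c * SelectiveLearning.rate n m)) ∧
      -- arbitrary algorithms, for `m ≥ n ^ g n` with `g n = ω(log log n)`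
      (∀ g : ℕ → ℝ,
        Tendsto (fun n : ℕ => g n / Real.log (Real.log (n : ℝ))) atTop atTop →
          (∃ n₀ : ℕ, ∀ n m : ℕ, n₀ ≤ n → 1 ≤ n → 2 ≤ m → (n : ℝ) ^ g n ≤ (m : ℝ) →
            ∀ A : SelectiveLearning.Algorithm.{u} n,
              A.HasHardInstance m (c * SelectiveLearning.rate n m)) ∧
          (∃ c' : ℝ, 0 < c' ∧ ∀ n m : ℕ, 1 ≤ n → 2 ≤ m → (n : ℝ) ^ g n ≤ (m : ℝ) →
            ∀ A : SelectiveLearning.Algorithm.{u} n,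
              A.HasHardInstance m (c' * SelectiveLearning.rate n m))) := by
  refine ⟨1 / 192, by norm_num, fun n m hn hm A hA =>
    (A.hasHardInstance_of_isNonAdaptive hm hA).mono
      (SelectiveLearning.rate_le_of_isNonAdaptive hn hm), fun g hg => ?_⟩
  obtain ⟨n₀, hn₀⟩ := eventually_atTop.1 (SelectiveLearning.eventually_large_exponent hg)
  have hlarge : ∀ n m : ℕ, n₀ ≤ n → 1 ≤ n → 2 ≤ m → (n : ℝ) ^ g n ≤ (m : ℝ) →
      ∀ A : SelectiveLearning.Algorithm.{u} n,
        A.HasHardInstance m (1 / 192 * SelectiveLearning.rate n m) := by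
    intro n m h₀ hn _ hm A
    obtain ⟨hlog, hgn⟩ := hn₀ n h₀
    have hn' : (0 : ℝ) < n := by exact_mod_cast hn
    have hlogm := Real.log_le_log (Real.rpow_pos_of_pos hn' _) hm
    rw [Real.log_rpow hn'] at hlogm
    obtain ⟨r, hr, hrm, hrate⟩ := SelectiveLearning.exists_branching hlog
      (hlogm.trans' (mul_le_mul_of_nonneg_right hgn (by linarith)))
    exact (A.hasHardInstance_of_mul_pow_le hr hrm).mono hrate
  -- For `n ≤ n₀` the bound `1 / 2 ^ n` is at least `1 / 2 ^ n₀`, and the rate is at most 1.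
  refine ⟨⟨n₀, hlarge⟩, min (1 / 192) (1 / 2 ^ n₀), by positivity, fun n m hn hm hgm A => ?_⟩
  have h0 := SelectiveLearning.rate_nonneg n m
  rcases le_total n₀ n with h | h
  · exact (hlarge n m h hn hm hgm A).mono (mul_le_mul_of_nonneg_right (min_le_left _ _) h0)
  · refine (A.hasHardInstance_one_div_two_pow hm).mono ?_
    calc min (1 / 192) (1 / 2 ^ n₀) * SelectiveLearning.rate n m
        ≤ (1 / 2 ^ n₀ : ℝ) * 1 := mul_le_mul (min_le_right _ _)
          (SelectiveLearning.rate_le_one n m) h0 (by positivity)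
      _ ≤ 1 / 2 ^ n := by
        rw [mul_one]
        exact one_div_le_one_div_of_le (by positivity) (pow_le_pow_right₀ (by norm_num) h)
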